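/- Let $A\in\mathbb{R}^{n\times n}$ and $b\in\mathbb{R}^n$. Write $\|\cdot\|$ for the Euclidean vector norm and for the spectral matrix norm, $|x|$ for the componentwise absolute value, $e(x)=Ax-|x|-b$, and $S^*=\{x\in\mathbb{R}^n : e(x)=0\}$ for the solution set of the absolute value equation $Ax-|x|-b=0$. For a symmetric positive definite $G\in\mathbb{R}^{n\times n}$ and parameters $\gamma\in(0,2)$, $\delta\in(0,1)$, $\mu>0$, the inexact Douglas-Rachford splitting method is the following algorithm. Start from an arbitrary $x^0\in\mathbb{R}^n$. For $k=0,1,\dots$, if $x^k\notin S^*$, choose any $x^{k+1}$ such that $$\|\Theta_k(x^{k+1})\|\le\alpha_k\|e(x^k)\|,\qquad \Theta_k(x)=2Ax-2Ax^k+\gamma\rho(x^k)G^{-1}e(x^k),\qquad \rho(x)=\frac{\|e(x)\|^2}{e(x)^TG^{-1}e(x)},$$ for some tolerance $\alpha_k$ with $$0\le\alpha_k\le\frac{(1-\delta)\gamma(2-\gamma)\rho(x^k)}{4\mu\|A^TG\|+2\gamma\rho(x^k)+\lambda_{\max}(G)}\ (<1),$$ where $\lambda_{\max}(G)$ is the largest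 eigenvalue of $G$; if $x^k\in S^*$, the method stops. **Theorem 4.5.** Assume that $A$ is invertible with $\|A^{-1}\|=1$, and that the absolute value equation has no solution, i.e. $S^*=\emptyset$. Let $G$ be symmetric positive definite. Then there is $\mu_0>0$, depending only on $A$, $b$ and $G$, such that for all $\mu\ge\mu_0$, $\gamma\in(0,2)$, $\delta\in(0,1)$ and every starting point $x^0$, every sequence $\{x^k\}$ generated by the method diverges to infinity: $\|x^k\|\to\infty$ as $k\to\infty$. -/

import Mathlib

noncomputable section

namespace AVE

/-- The space `ℝⁿ` with the Euclidean norm. -/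
abbrev Vec (n : ℕ) : Type := EuclideanSpace ℝ (Fin n)

/-- The matrix-vector product `M x` on Euclidean space, as a continuous linear map. -/
def act {n : ℕ} (M : Matrix (Fin n) (Fin n) ℝ) : Vec n →L[ℝ] Vec n :=
  Matrix.toEuclideanCLM (n := Fin n) (𝕜 := ℝ) M

/-- The spectral norm `‖M‖`, the operator norm induced by the Euclidean vector norm. -/
def specNorm {n : ℕ} (M : Matrix (Fin n) (Fin n) ℝ) : ℝ := ‖act M‖

/-- The largest eigenvalue of a symmetric real matrix. -/
def lambdaMax {n : ℕ} (M : Matrix (Fin n) (Fin n) ℝ) : ℝ := sSup (spectrum ℝ M)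

/-- The componentwise absolute value `|x|`. -/
def vabs {n : ℕ} (x : Vec n) : Vec n := WithLp.toLp 2 (fun i => |x i|)

/-- The residual `e(x) = A x - |x| - b` of the absolute value equation. -/
def residual {n : ℕ} (A : Matrix (Fin n) (Fin n) ℝ) (b x : Vec n) : Vec n :=
  act A x - vabs x - b

/-- The solution set `S*` of the absolute value equation `A x - |x| - b = 0`. -/
def solutionSet {n : ℕ} (A : Matrix (Fin n) (Fin n) ℝ) (b : Vec n) : Set (Vec n) :=
  {x | act A x - vabs x - b = 0}

/-- `ρ(x) = ‖e(x)‖² / (e(x)ᵀ G⁻¹ e(x))`; it is only used where `e(x) ≠ 0`. -/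
def rho {n : ℕ} (A G : Matrix (Fin n) (Fin n) ℝ) (b x : Vec n) : ℝ :=
  ‖residual A b x‖ ^ 2 / inner ℝ (residual A b x) (act G⁻¹ (residual A b x))

/-- The map of the subproblem at the current iterate `xk`:
`Θ(x) = 2 A x - 2 A xk + γ ρ(xk) G⁻¹ (A xk - |xk| - b)`. -/
def Theta {n : ℕ} (A G : Matrix (Fin n) (Fin n) ℝ) (b : Vec n) (γ : ℝ) (xk x : Vec n) : Vec n :=
  (2 : ℝ) • act A x - (2 : ℝ) • act A xk + (γ * rho A G b xk) • act G⁻¹ (residual A b xk)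

/-- The upper bound on the relative tolerance `α` at the current iterate `xk`.
For positive definite `G`, `γ ∈ (0,2)`, `δ ∈ (0,1)`, `μ > 0` it lies in `(0,1)` whenever
`xk` is not a solution. -/
def alphaBound {n : ℕ} (A G : Matrix (Fin n) (Fin n) ℝ) (b : Vec n) (γ δ μ : ℝ) (xk : Vec n) : ℝ :=
  ((1 - δ) * γ * (2 - γ) * rho A G b xk) /
    (4 * μ * specNorm (A.transpose * G) + 2 * γ * rho A G b xk + lambdaMax G)

/-- `x` is a sequence generated by the inexact Douglas-Rachford splitting method with parameters
`γ`, `δ`, `μ`, `G`, started at `x 0`: as long as the current iterate is not a solution, the next one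
solves the subproblem up to an admissible relative tolerance `α`; at a solution the method stops,
which is recorded by repeating the iterate. -/
def IsInexactDRS {n : ℕ} (A G : Matrix (Fin n) (Fin n) ℝ) (b : Vec n) (γ δ μ : ℝ)
    (x : ℕ → Vec n) : Prop :=
  ∀ k : ℕ,
    (x k ∉ solutionSet A b →
      ∃ α : ℝ, 0 ≤ α ∧ α ≤ alphaBound A G b γ δ μ (x k) ∧
        ‖Theta A G b γ (x k) (x (k + 1))‖ ≤ α * ‖residual A b (x k)‖) ∧
    (x k ∈ solutionSet A b → x (k + 1) = x k)

end AVE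

end

namespace AVE

open Filter Topology

/-! Write `e₀(x) = Ax - |x|`, so `e = e₀ - b`. Since `‖A⁻¹‖ = 1`, both are `1/2`-cocoercive as
functions of `Ax`. The regularized equations `εAx + e(x) = 0` are solvable; monotonicity makes their
residuals bounded, and a limit point `v` as `ε → 0` satisfies `⟨v, e(x)⟩ ≥ ‖v‖²` for all `x`. The
range of `e` is closed because `e` is piecewise affine, so unsolvability gives `v ≠ 0`
(`exists_separating_vector`).

A step reads `Ax' = Ax - (γρ/2) G⁻¹e(x) + r`, with `‖r‖` of order `γ(2-γ)‖e(x)‖/μ`. Hence `ℓ(x) =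
⟨v, GAx⟩` falls by a fixed multiple of `γ`, up to the error from `r`. As `‖e(x)‖` has no a priori
bound, a large `μ` alone does not control this error.

The remedy is an energy `W`: the squared `G`-distance from `Ax` to the image under `A` of the cone
`e₀ = 0`. Cocoercivity against the nearest cone point, with a Hoffman-type bound of the distance by
`‖e₀(x)‖`, makes `W` drop when `‖e₀(x)‖` is large (`exists_energy`). Adding a small multiple of `W`
to `ℓ` pays for the error: the sum decreases linearly in `k`, and `W ≥ 0` forces `ℓ(x k) → -∞`,
which a bounded linear functional allows only if `‖x k‖ → ∞`. -/

/-! ### Hoffman-type bounds on polyhedral cones -/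

/-- By compactness `‖M x‖` has a positive minimum on the unit vectors of the cone; homogeneity does
the rest. -/
theorem exists_norm_le_of_closed_cone {F E : Type*} [NormedAddCommGroup F] [NormedSpace ℝ F]
    [FiniteDimensional ℝ F] [NormedAddCommGroup E] [NormedSpace ℝ E] (M : F →L[ℝ] E)
    {S : Set F} (hS : IsClosed S) (hcone : ∀ c : ℝ, 0 ≤ c → ∀ x ∈ S, c • x ∈ S)
    (hM : ∀ x ∈ S, M x = 0 → x = 0) :
    ∃ C : ℝ, 0 ≤ C ∧ ∀ x ∈ S, ‖x‖ ≤ C * ‖M x‖ := by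
  have hK : IsCompact (Metric.sphere (0 : F) 1 ∩ S) := (isCompact_sphere 0 1).inter_right hS
  obtain ⟨m, hm0, hm⟩ : ∃ m : ℝ, 0 < m ∧ ∀ x ∈ Metric.sphere (0 : F) 1 ∩ S, m ≤ ‖M x‖ := by
    rcases (Metric.sphere (0 : F) 1 ∩ S).eq_empty_or_nonempty with h | h
    · exact ⟨1, one_pos, by simp [h]⟩
    · obtain ⟨x, hx, hmin⟩ := hK.exists_isMinOn h (M.continuous.norm.continuousOn)
      refine ⟨‖M x‖, norm_pos_iff.2 fun h0 => ?_, fun y hy => hmin hy⟩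
      have := hx.1
      rw [hM x hx.2 h0] at this
      simp at this
  refine ⟨m⁻¹, by positivity, fun x hx => ?_⟩
  rcases eq_or_ne x 0 with rfl | h0
  · simp
  have hx0 : 0 < ‖x‖ := norm_pos_iff.2 h0
  have h := hm (‖x‖⁻¹ • x) ⟨by simp [norm_smul, hx0.ne'], hcone _ (by positivity) x hx⟩
  rw [map_smul, norm_smul, norm_inv, norm_norm, inv_mul_eq_div, le_div_iff₀ hx0] at h
  rw [inv_mul_eq_div, le_div_iff₀ hm0]
  linarith

/-- Conformal decomposition of a nonnegative vector relative to the kernel of a linear map. -/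
theorem exists_conformal_decomposition {ι E : Type*} [Fintype ι] [NormedAddCommGroup E]
    [NormedSpace ℝ E] (M : (ι → ℝ) →L[ℝ] E) :
    ∃ C : ℝ, 0 ≤ C ∧ ∀ p : ι → ℝ, 0 ≤ p →
      ∃ q : ι → ℝ, 0 ≤ q ∧ q ≤ p ∧ M q = 0 ∧ ‖p - q‖ ≤ C * ‖M p‖ := by
  classical
  let S : Set ι → Set (ι → ℝ) := fun I => {x | 0 ≤ x ∧ ∀ i ∉ I, x i = 0}
  have hface : ∀ I : Set ι, ∃ C : ℝ, 0 ≤ C ∧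
      ((∀ x ∈ S I, M x = 0 → x = 0) → ∀ x ∈ S I, ‖x‖ ≤ C * ‖M x‖) := by
    intro I
    by_cases h : ∀ x ∈ S I, M x = 0 → x = 0
    · have hcl : IsClosed (S I) := by
        have hSI : S I = {x | 0 ≤ x} ∩ ⋂ i, ⋂ _ : i ∉ I, {x : ι → ℝ | x i = 0} := by
          ext x; simp [S]
        rw [hSI]
        refine (isClosed_le continuous_const continuous_id).inter ?_
        exact isClosed_iInter fun i => isClosed_iInter fun _ =>
          isClosed_eq (continuous_apply i) continuous_const
      have hcone : ∀ c : ℝ, 0 ≤ c → ∀ x ∈ S I, c • x ∈ S I := by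
        rintro c hc x ⟨hx, hx'⟩
        exact ⟨smul_nonneg hc hx, fun i hi => by simp [hx' i hi]⟩
      obtain ⟨C, hC, hb⟩ := exists_norm_le_of_closed_cone M hcl hcone h
      exact ⟨C, hC, fun _ => hb⟩
    · exact ⟨0, le_rfl, fun h' => absurd h' h⟩
  choose C hC0 hC using hface
  -- There is one constant per support set and finitely many supports, so the sum dominates
  -- whichever one occurs.
  refine ⟨∑ I, C I, Finset.sum_nonneg fun I _ => hC0 I, fun p hp => ?_⟩
  have hK : IsCompact (Set.Icc 0 p ∩ {q | M q = 0}) :=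
    isCompact_Icc.inter_right (isClosed_eq M.continuous continuous_const)
  obtain ⟨q, ⟨⟨hq0, hqp⟩, hMq⟩, hmax⟩ := hK.exists_isMaxOn ⟨0, ⟨le_rfl, hp⟩, map_zero M⟩
    (f := fun q => ∑ i, q i) (by fun_prop)
  have hMq : M q = 0 := hMq
  refine ⟨q, hq0, hqp, hMq, ?_⟩
  set I : Set ι := {i | q i < p i} with hI
  have hmem : p - q ∈ S I := by
    refine ⟨sub_nonneg.2 hqp, fun i hi => ?_⟩
    have h1 := hqp i
    have h2 : ¬ q i < p i := hi
    simp only [Pi.sub_apply]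
    linarith
  -- A nonzero kernel vector `x ≥ 0` supported where `q < p` could be added to `q` in a small
  -- multiple, contradicting the maximality of the coordinate sum.
  have hker : ∀ x ∈ S I, M x = 0 → x = 0 := by
    rintro x ⟨hx0, hxI⟩ hMx
    obtain ⟨t, ht, htx⟩ : ∃ t : ℝ, 0 < t ∧ ∀ i, t * x i ≤ p i - q i := by
      have : ∀ᶠ t in 𝓝[>] (0 : ℝ), ∀ i, t * x i ≤ p i - q i := by
        refine eventually_all.2 fun i => ?_
        by_cases hi : i ∈ I
        · have hlt : (0 : ℝ) * x i < p i - q i := by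
            have : q i < p i := hi
            linarith
          have hc : Continuous fun t : ℝ => t * x i := by fun_prop
          exact ((hc.tendsto 0).eventually_lt_const hlt).filter_mono nhdsWithin_le_nhds
            |>.mono fun t h => h.le
        · exact Eventually.of_forall fun t => by
            rw [hxI i hi, mul_zero]; exact sub_nonneg.2 (hqp i)
      obtain ⟨t, h1, h2⟩ := (this.and self_mem_nhdsWithin).exists
      exact ⟨t, h2, h1⟩
    have h := hmax (a := q + t • x) ⟨⟨add_nonneg hq0 (smul_nonneg ht.le hx0), fun i => by
      have := htx i
      simp only [Pi.add_apply, Pi.smul_apply, smul_eq_mul]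
      linarith⟩, by simp [hMq, hMx]⟩
    simp only [Set.mem_ofPred_eq, Pi.add_apply, Pi.smul_apply, smul_eq_mul,
      Finset.sum_add_distrib, ← Finset.mul_sum] at h
    have h' : ∑ i, x i = 0 := by
      have : 0 ≤ ∑ i, x i := Finset.sum_nonneg fun i _ => hx0 i
      nlinarith
    funext i
    exact (Finset.sum_eq_zero_iff_of_nonneg fun i _ => hx0 i).1 h' i (Finset.mem_univ i)
  have h := hC I hker _ hmem
  rw [map_sub, hMq, sub_zero] at h
  refine h.trans (mul_le_mul_of_nonneg_right ?_ (norm_nonneg _))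
  exact Finset.single_le_sum (fun J _ => hC0 J) (Finset.mem_univ I)

/-! ### Error bound for the homogeneous equation and closed range of the residual -/

theorem vabs_apply {n : ℕ} (x : Vec n) (i : Fin n) : vabs x i = |x i| := rfl

theorem norm_vabs_sub_le {n : ℕ} (x y : Vec n) : ‖vabs x - vabs y‖ ≤ ‖x - y‖ := by
  rw [EuclideanSpace.norm_eq, EuclideanSpace.norm_eq]
  refine Real.sqrt_le_sqrt (Finset.sum_le_sum fun i _ => ?_)
  gcongr
  simpa [vabs_apply] using abs_abs_sub_abs_le (x i) (y i)

theorem vabs_zero {n : ℕ} : vabs (0 : Vec n) = 0 := by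
  ext i; simp [vabs_apply]

theorem continuous_vabs {n : ℕ} : Continuous (vabs (n := n)) :=
  LipschitzWith.continuous (K := 1) <| LipschitzWith.of_dist_le_mul fun x y => by
    simpa [dist_eq_norm] using norm_vabs_sub_le x y

theorem continuous_residual {n : ℕ} (A : Matrix (Fin n) (Fin n) ℝ) (b : Vec n) :
    Continuous (residual A b) :=
  ((act A).continuous.sub continuous_vabs).sub continuous_const

theorem residual_eq_sub {n : ℕ} (A : Matrix (Fin n) (Fin n) ℝ) (b x : Vec n) :
    residual A b x = residual A 0 x - b := by
  simp [residual]

/-- Error bound for the homogeneous absolute value equation `A x = |x|`. -/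
theorem exists_homogeneous_error_bound {n : ℕ} (A : Matrix (Fin n) (Fin n) ℝ) :
    ∃ C : ℝ, 0 ≤ C ∧ ∀ x : Vec n, ∃ z : Vec n, residual A 0 z = 0 ∧
      residual A 0 (x - z) = residual A 0 x ∧ ‖x - z‖ ≤ C * ‖residual A 0 x‖ := by
  classical
  let ε : (Fin n → Bool) → Fin n → ℝ := fun s i => if s i then 1 else -1
  have hε : ∀ s i, |ε s i| = 1 := fun s i => by
    simp only [ε]; split_ifs <;> simp
  let T : (Fin n → ℝ) →L[ℝ] Vec n := (EuclideanSpace.equiv (Fin n) ℝ).symm.toContinuousLinearMap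
  let N : (Fin n → Bool) → (Fin n → ℝ) →L[ℝ] Vec n := fun s =>
    T.comp (ContinuousLinearMap.pi fun i => (ε s i) • ContinuousLinearMap.proj i)
  have hT : ∀ p i, T p i = p i := fun p i => rfl
  have hN : ∀ s p i, N s p i = ε s i * p i := fun s p i => rfl
  let M : (Fin n → Bool) → (Fin n → ℝ) →L[ℝ] Vec n := fun s => (act A).comp (N s) - T
  have hres : ∀ s p, 0 ≤ p → residual A 0 (N s p) = M s p := by
    intro s p hp
    have : vabs (N s p) = T p := by
      ext i
      rw [vabs_apply, hN, hT, abs_mul, hε, one_mul, abs_of_nonneg (hp i)]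
    simp [residual, M, this]
  choose C hC0 hC using fun s => exists_conformal_decomposition (M s)
  refine ⟨∑ s, ‖N s‖ * C s, Finset.sum_nonneg fun s _ => mul_nonneg (norm_nonneg _) (hC0 s),
    fun x => ?_⟩
  -- On the orthant with sign pattern `s` the map `e₀` is linear. Since `0 ≤ q ≤ p`, the points `z`
  -- and `x - z` stay in the orthant of `x`, so the residuals subtract.
  let s : Fin n → Bool := fun i => decide (0 ≤ x i)
  let p : Fin n → ℝ := fun i => |x i|
  have hp : 0 ≤ p := fun i => abs_nonneg _
  have hx : N s p = x := by
    ext i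
    rw [hN]
    by_cases h : 0 ≤ x i
    · simp [ε, s, p, h, abs_of_nonneg]
    · simp [ε, s, p, h, abs_of_neg (not_le.1 h)]
  obtain ⟨q, hq0, hqp, hMq, hle⟩ := hC s p hp
  have hxz : x - N s q = N s (p - q) := by rw [map_sub, hx]
  have hrx : residual A 0 x = M s p := by rw [← hres s p hp, hx]
  refine ⟨N s q, by rw [hres s q hq0, hMq], ?_, ?_⟩
  · rw [hxz, hres s _ (sub_nonneg.2 hqp), map_sub, hMq, sub_zero, hrx]
  · rw [hxz, hrx]
    calc ‖N s (p - q)‖ ≤ ‖N s‖ * (C s * ‖M s p‖) :=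
          (N s).le_opNorm_of_le hle
      _ = (‖N s‖ * C s) * ‖M s p‖ := by ring
      _ ≤ _ := by
        refine mul_le_mul_of_nonneg_right ?_ (norm_nonneg _)
        exact Finset.single_le_sum (f := fun s => ‖N s‖ * C s)
          (fun s _ => mul_nonneg (norm_nonneg _) (hC0 s)) (Finset.mem_univ s)

theorem exists_residual_eq_norm_le {n : ℕ} (A : Matrix (Fin n) (Fin n) ℝ) (b : Vec n) :
    ∃ C : ℝ, 0 ≤ C ∧ ∀ x : Vec n, ∃ x' : Vec n, residual A b x' = residual A b x ∧
      ‖x'‖ ≤ C * (‖residual A b x‖ + ‖b‖) := by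
  obtain ⟨C, hC0, hC⟩ := exists_homogeneous_error_bound A
  refine ⟨C, hC0, fun x => ?_⟩
  obtain ⟨z, -, h2, h3⟩ := hC x
  refine ⟨x - z, by rw [residual_eq_sub, h2, ← residual_eq_sub], h3.trans ?_⟩
  gcongr
  rw [residual_eq_sub A b x]
  simpa using norm_add_le (residual A 0 x - b) b

/-- Preimages of a convergent sequence of residuals can be replaced by bounded ones with the same
residuals, and these have a limit point. -/
theorem isClosed_range_residual {n : ℕ} (A : Matrix (Fin n) (Fin n) ℝ) (b : Vec n) :
    IsClosed (Set.range (residual A b)) := by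
  obtain ⟨C, hC0, hC⟩ := exists_residual_eq_norm_le A b
  choose f hf hfn using hC
  refine IsSeqClosed.isClosed fun u v hu huv => ?_
  choose x hx using hu
  obtain ⟨R, hR⟩ := huv.norm.bddAbove_range
  have hbd : ∀ k, f (x k) ∈ Metric.closedBall (0 : Vec n) (C * (R + ‖b‖)) := fun k => by
    rw [mem_closedBall_zero_iff]
    refine (hfn (x k)).trans ?_
    gcongr
    rw [hx]
    exact hR ⟨k, rfl⟩
  obtain ⟨a, -, φ, hφ, ha⟩ := (isCompact_closedBall (0 : Vec n) _).tendsto_subseq hbd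
  refine ⟨a, tendsto_nhds_unique (((continuous_residual A b).tendsto a).comp ha) ?_⟩
  have : (residual A b ∘ (fun k => f (x k)) ∘ φ) = u ∘ φ := by
    funext k; simp [hf, hx]
  exact (this ▸ huv.comp hφ.tendsto_atTop)

/-! ### Cocoercivity and separation of the residuals from zero -/

theorem act_mul_apply {n : ℕ} (M N : Matrix (Fin n) (Fin n) ℝ) (x : Vec n) :
    act (M * N) x = act M (act N x) := by
  simp [act]

theorem act_one_apply {n : ℕ} (x : Vec n) : act (1 : Matrix (Fin n) (Fin n) ℝ) x = x := by
  simp [act]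

/-- The inverse of a singular matrix is `0` by convention, and its norm is not `1`. -/
theorem isUnit_det_of_specNorm_inv {n : ℕ} {A : Matrix (Fin n) (Fin n) ℝ}
    (hA : specNorm A⁻¹ = 1) : IsUnit A.det := by
  by_contra h
  rw [Matrix.nonsing_inv_apply_not_isUnit A h] at hA
  simp [specNorm, act] at hA

theorem act_inv_act {n : ℕ} {A : Matrix (Fin n) (Fin n) ℝ} (h : IsUnit A.det) (x : Vec n) :
    act A⁻¹ (act A x) = x := by
  rw [← act_mul_apply, Matrix.nonsing_inv_mul _ h, act_one_apply]

theorem act_act_inv {n : ℕ} {A : Matrix (Fin n) (Fin n) ℝ} (h : IsUnit A.det) (x : Vec n) :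
    act A (act A⁻¹ x) = x := by
  rw [← act_mul_apply, Matrix.mul_nonsing_inv _ h, act_one_apply]

theorem norm_act_inv_le {n : ℕ} {A : Matrix (Fin n) (Fin n) ℝ} (hA : specNorm A⁻¹ = 1)
    (y : Vec n) : ‖act A⁻¹ y‖ ≤ ‖y‖ := by
  have := (act A⁻¹).le_opNorm y
  rwa [show ‖act A⁻¹‖ = 1 from hA, one_mul] at this

/-- The residual is `1/2`-cocoercive as a function of `A x`. -/
theorem residual_cocoercive {n : ℕ} {A : Matrix (Fin n) (Fin n) ℝ} (hA : specNorm A⁻¹ = 1)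
    (b x y : Vec n) : ‖residual A b x - residual A b y‖ ^ 2 / 2 ≤
      inner ℝ (act A x - act A y) (residual A b x - residual A b y) := by
  have h1 : residual A b x - residual A b y = (act A x - act A y) - (vabs x - vabs y) := by
    simp only [residual]; abel
  have h2 : ‖vabs x - vabs y‖ ≤ ‖act A x - act A y‖ := by
    refine (norm_vabs_sub_le x y).trans ?_
    have := norm_act_inv_le hA (act A (x - y))
    rwa [act_inv_act (isUnit_det_of_specNorm_inv hA), map_sub] at this
  have h3 : ‖vabs x - vabs y‖ ^ 2 ≤ ‖act A x - act A y‖ ^ 2 := by gcongr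
  -- With `a = Ax - Ay` and `c = |x| - |y|`, `⟨a, a - c⟩ - ‖a - c‖²/2 = (‖a‖² - ‖c‖²)/2`, which is
  -- nonnegative by `h3`.
  rw [h1, norm_sub_sq_real, inner_sub_right _ (act A x - act A y) (vabs x - vabs y),
    real_inner_self_eq_norm_sq]
  linarith

/-- The regularized equation `ε A x + e(x) = 0` is solvable. -/
theorem exists_residual_eq_neg_smul {n : ℕ} {A : Matrix (Fin n) (Fin n) ℝ}
    (hA : specNorm A⁻¹ = 1) (b : Vec n) {ε : ℝ} (hε : 0 < ε) :
    ∃ x : Vec n, residual A b x = -(ε • act A x) := by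
  have hdet := isUnit_det_of_specNorm_inv hA
  let f : Vec n → Vec n := fun x => (1 + ε)⁻¹ • act A⁻¹ (vabs x + b)
  have hpos : (0 : ℝ) ≤ (1 + ε)⁻¹ := by positivity
  have hf : ContractingWith (1 + ε)⁻¹.toNNReal f := by
    refine ⟨?_, LipschitzWith.of_dist_le_mul fun x y => ?_⟩
    · rw [Real.toNNReal_lt_one]
      exact inv_lt_one_of_one_lt₀ (by linarith)
    · simp only [f, dist_eq_norm, ← smul_sub, ← map_sub, norm_smul, Real.coe_toNNReal _ hpos,
        add_sub_add_right_eq_sub]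
      rw [Real.norm_of_nonneg hpos]
      gcongr
      exact (norm_act_inv_le hA _).trans (norm_vabs_sub_le x y)
  obtain ⟨x, hx, -⟩ := hf.exists_fixedPoint 0 (edist_ne_top _ _)
  have hx : (1 + ε)⁻¹ • act A⁻¹ (vabs x + b) = x := hx
  have h : act A x = (1 + ε)⁻¹ • (vabs x + b) := by
    conv_lhs => rw [← hx, map_smul, act_act_inv hdet]
  have h' : (1 + ε) • act A x = vabs x + b := by
    rw [h, smul_inv_smul₀ (by positivity)]
  refine ⟨x, ?_⟩
  have : act A x + ε • act A x = vabs x + b := by rw [← h', add_smul, one_smul]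
  rw [residual, ← sub_eq_zero, sub_neg_eq_add]
  rw [← sub_eq_zero] at this
  rw [← this]; abel

/-- If the absolute value equation is unsolvable, a hyperplane strictly separates the residuals
from zero. -/
theorem exists_separating_vector {n : ℕ} {A : Matrix (Fin n) (Fin n) ℝ}
    (hA : specNorm A⁻¹ = 1) {b : Vec n} (hS : solutionSet A b = ∅) :
    ∃ v : Vec n, ∃ c : ℝ, 0 < c ∧ ∀ x, c ≤ inner ℝ v (residual A b x) := by
  choose y hy using fun k : ℕ =>
    exists_residual_eq_neg_smul hA b (ε := 1 / ((k : ℝ) + 1)) Nat.one_div_pos_of_nat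
  let u : ℕ → Vec n := fun k => residual A b (y k)
  -- Monotonicity between `x` and `y k`, multiplied by `ε`, where `ε A (y k) = -u k`. The last term
  -- vanishes as `ε → 0`.
  have key : ∀ k x, ‖u k‖ ^ 2 ≤ inner ℝ (u k) (residual A b x) +
      1 / ((k : ℝ) + 1) * inner ℝ (act A x) (residual A b x - u k) := by
    intro k x
    have hε : 0 < 1 / ((k : ℝ) + 1) := Nat.one_div_pos_of_nat
    have h := (by positivity : (0 : ℝ) ≤ _).trans (residual_cocoercive hA b x (y k))
    have h2 := mul_nonneg hε.le h
    rw [inner_sub_left, mul_sub, ← real_inner_smul_left (act A (y k))] at h2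
    have h3 : (1 / ((k : ℝ) + 1)) • act A (y k) = - u k := by
      simp only [u]; rw [hy k, neg_neg]
    rw [h3, inner_neg_left, inner_sub_right (u k) (residual A b x) (residual A b (y k))] at h2
    change _ ≤ _ - -(_ - inner ℝ (u k) (u k)) at h2
    rw [real_inner_self_eq_norm_sq] at h2
    simp only [u] at h2 ⊢
    linarith
  have hbd : ∀ k, u k ∈ Metric.closedBall (0 : Vec n) ‖residual A b 0‖ := by
    intro k
    have h := key k 0
    rw [map_zero, inner_zero_left, mul_zero, add_zero] at h
    have h' := real_inner_le_norm (u k) (residual A b 0)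
    rw [mem_closedBall_zero_iff]
    by_contra hlt
    push Not at hlt
    nlinarith [norm_nonneg (u k), norm_nonneg (residual A b 0)]
  obtain ⟨v, -, φ, hφ, hv⟩ := (isCompact_closedBall (0 : Vec n) _).tendsto_subseq hbd
  have hv0 : v ≠ 0 := by
    rintro rfl
    obtain ⟨x, hx⟩ := (isClosed_range_residual A b).mem_of_tendsto hv
      (Eventually.of_forall fun k => ⟨_, rfl⟩)
    exact (hS ▸ (show x ∈ solutionSet A b from hx) : x ∈ (∅ : Set (Vec n)))
  refine ⟨v, ‖v‖ ^ 2, by positivity, fun x => ?_⟩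
  have hε : Tendsto (fun k => 1 / ((φ k : ℝ) + 1)) atTop (𝓝 0) :=
    tendsto_one_div_add_atTop_nhds_zero_nat.comp hφ.tendsto_atTop
  have hlim : Tendsto (fun k => inner ℝ (u (φ k)) (residual A b x) +
      1 / ((φ k : ℝ) + 1) * inner ℝ (act A x) (residual A b x - u (φ k))) atTop
      (𝓝 (inner ℝ v (residual A b x) + 0 * inner ℝ (act A x) (residual A b x - v))) :=
    (hv.inner tendsto_const_nhds).add
      (hε.mul (tendsto_const_nhds.inner (tendsto_const_nhds.sub hv)))
  rw [zero_mul, add_zero] at hlim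
  exact le_of_tendsto_of_tendsto' (hv.norm.pow 2) hlim fun k => key (φ k) x

/-! ### The metric of `G` and the perturbed step -/

theorem inner_act_pos {n : ℕ} {M : Matrix (Fin n) (Fin n) ℝ} (hM : M.PosDef) {u : Vec n}
    (hu : u ≠ 0) : 0 < inner ℝ u (act M u) := by
  have h : u.ofLp ≠ 0 := fun h => hu (by ext i; exact congrFun h i)
  have := hM.dotProduct_mulVec_pos h
  rwa [act, Matrix.inner_toEuclideanCLM]

theorem inner_act_comm {n : ℕ} {M : Matrix (Fin n) (Fin n) ℝ} (hM : M.PosDef) (u w : Vec n) :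
    inner ℝ u (act M w) = inner ℝ w (act M u) := by
  have hT : M.transpose = M := by simpa using hM.isHermitian.eq
  rw [act, Matrix.inner_toEuclideanCLM, Matrix.inner_toEuclideanCLM,
    Matrix.dotProduct_mulVec, ← Matrix.mulVec_transpose, hT, dotProduct_comm]

theorem exists_coercive {n : ℕ} {M : Matrix (Fin n) (Fin n) ℝ} (hM : M.PosDef) :
    ∃ m : ℝ, 0 < m ∧ ∀ u : Vec n, m * ‖u‖ ^ 2 ≤ inner ℝ u (act M u) := by
  have hcont : Continuous fun u : Vec n => (inner ℝ u (act M u) : ℝ) :=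
    continuous_id.inner (act M).continuous
  obtain ⟨m, hm0, hm⟩ : ∃ m : ℝ, 0 < m ∧
      ∀ u ∈ Metric.sphere (0 : Vec n) 1, m ≤ inner ℝ u (act M u) := by
    rcases (Metric.sphere (0 : Vec n) 1).eq_empty_or_nonempty with h | h
    · exact ⟨1, one_pos, by simp [h]⟩
    · obtain ⟨u, hu, hmin⟩ := (isCompact_sphere (0 : Vec n) 1).exists_isMinOn h hcont.continuousOn
      exact ⟨_, inner_act_pos hM (ne_zero_of_mem_unit_sphere ⟨u, hu⟩), fun w hw => hmin hw⟩
  refine ⟨m, hm0, fun u => ?_⟩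
  rcases eq_or_ne u 0 with rfl | h0
  · simp
  have hu : 0 < ‖u‖ := norm_pos_iff.2 h0
  have h := hm (‖u‖⁻¹ • u) (by simp [norm_smul, hu.ne'])
  rw [map_smul, real_inner_smul_left, real_inner_smul_right] at h
  calc m * ‖u‖ ^ 2 ≤ ‖u‖⁻¹ * (‖u‖⁻¹ * inner ℝ u (act M u)) * ‖u‖ ^ 2 := by gcongr
    _ = inner ℝ u (act M u) := by field_simp

theorem inner_act_le {n : ℕ} (M : Matrix (Fin n) (Fin n) ℝ) (u w : Vec n) :
    inner ℝ u (act M w) ≤ ‖u‖ * (‖act M‖ * ‖w‖) :=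
  (real_inner_le_norm _ _).trans <| by
    gcongr
    exact (act M).le_opNorm w

theorem lambdaMax_nonneg {n : ℕ} {M : Matrix (Fin n) (Fin n) ℝ} (hM : M.PosDef) :
    0 ≤ lambdaMax M := by
  refine Real.sSup_nonneg fun x hx => ?_
  rw [hM.isHermitian.spectrum_real_eq_range_eigenvalues] at hx
  obtain ⟨i, rfl⟩ := hx
  exact hM.posSemidef.eigenvalues_nonneg i

/-- `ρ` is the inverse Rayleigh quotient of `G⁻¹` at the residual, hence bounded above and away from
zero uniformly in `x`. -/
theorem exists_rho_bounds {n : ℕ} (A : Matrix (Fin n) (Fin n) ℝ) (b : Vec n)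
    {G : Matrix (Fin n) (Fin n) ℝ} (hG : G.PosDef) :
    ∃ a K : ℝ, 0 < a ∧ 0 < K ∧ ∀ x, residual A b x ≠ 0 →
      a ≤ rho A G b x ∧ rho A G b x ≤ K ∧
      rho A G b x * inner ℝ (residual A b x) (act G⁻¹ (residual A b x)) =
        ‖residual A b x‖ ^ 2 := by
  obtain ⟨m, hm, hmG⟩ := exists_coercive hG.inv
  refine ⟨(‖act G⁻¹‖ + 1)⁻¹, m⁻¹, by positivity, by positivity, fun x hx => ?_⟩
  have hpos := inner_act_pos hG.inv hx
  have he : 0 < ‖residual A b x‖ := norm_pos_iff.2 hx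
  refine ⟨?_, ?_, div_mul_cancel₀ _ hpos.ne'⟩
  · rw [rho, le_div_iff₀ hpos, inv_mul_le_iff₀ (by positivity)]
    nlinarith [inner_act_le G⁻¹ (residual A b x) (residual A b x)]
  · rw [rho, div_le_iff₀ hpos, inv_mul_eq_div, le_div_iff₀ hm]
    linarith [hmG (residual A b x)]

/-- `x'` is an admissible successor of the iterate `x`. -/
def InexactStep {n : ℕ} (A G : Matrix (Fin n) (Fin n) ℝ) (b : Vec n) (γ δ μ : ℝ)
    (x x' : Vec n) : Prop :=
  ∃ α : ℝ, 0 ≤ α ∧ α ≤ alphaBound A G b γ δ μ x ∧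
    ‖Theta A G b γ x x'‖ ≤ α * ‖residual A b x‖

theorem specNorm_pos {n : ℕ} {M : Matrix (Fin n) (Fin n) ℝ} (hn : 0 < n) (hM : IsUnit M.det) :
    0 < specNorm M := by
  refine norm_pos_iff.2 fun h => ?_
  have : Nonempty (Fin n) := ⟨⟨0, hn⟩⟩
  obtain ⟨u, hu⟩ := exists_ne (0 : Vec n)
  have := act_inv_act hM u
  rw [h] at this
  exact hu (by simpa using this.symm)

/-- An admissible step is an explicit step with a perturbation that is small relative to the
residual, the admissible size being inversely proportional to `μ`. -/
theorem exists_step_perturbation {n : ℕ} {A : Matrix (Fin n) (Fin n) ℝ}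
    (hA : specNorm A⁻¹ = 1) {b : Vec n} (hS : solutionSet A b = ∅)
    {G : Matrix (Fin n) (Fin n) ℝ} (hG : G.PosDef) :
    ∃ K : ℝ, 0 < K ∧ ∀ μ, 0 < μ → ∀ γ, 0 < γ → γ < 2 → ∀ δ, 0 < δ → δ < 1 → ∀ x x',
      InexactStep A G b γ δ μ x x' → ∃ r : Vec n,
        act A x' = act A x - (γ * rho A G b x / 2) • act G⁻¹ (residual A b x) + r ∧
        ‖r‖ ≤ γ * (2 - γ) * (K / μ) * ‖residual A b x‖ := by
  have hAd := isUnit_det_of_specNorm_inv hA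
  have hn : 0 < n := by
    rcases Nat.eq_zero_or_pos n with rfl | h
    · simp [specNorm] at hA
    · exact h
  have hκ : 0 < specNorm (A.transpose * G) := by
    refine specNorm_pos hn ?_
    rw [Matrix.det_mul, Matrix.det_transpose]
    exact hAd.mul hG.det_pos.ne'.isUnit
  obtain ⟨a, K, ha, hK, hρ⟩ := exists_rho_bounds A b hG
  refine ⟨K / (4 * specNorm (A.transpose * G)), by positivity,
    fun μ hμ γ hγ hγ2 δ hδ hδ1 x x' ⟨α, hα0, hα, hstep⟩ => ?_⟩
  have hx : residual A b x ≠ 0 := fun h =>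
    (hS ▸ (show x ∈ solutionSet A b from h) : x ∈ (∅ : Set (Vec n)))
  obtain ⟨hρa, hρK, -⟩ := hρ x hx
  have hρ0 : 0 < rho A G b x := ha.trans_le hρa
  have h2γ : 0 < 2 - γ := by linarith
  have hαb : α ≤ γ * (2 - γ) * (K / (4 * specNorm (A.transpose * G)) / μ) := by
    calc α ≤ _ := hα
      -- Only the `μ` term of the denominator is kept. The factor `γ(2-γ)` must survive, since `μ₀`
      -- may not depend on `γ`.
      _ ≤ (γ * (2 - γ) * K) / (4 * μ * specNorm (A.transpose * G)) := by
        rw [alphaBound]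
        refine div_le_div₀ (by positivity) ?_ (by positivity) ?_
        · have h1 : (1 - δ) * (γ * (2 - γ)) ≤ γ * (2 - γ) :=
            mul_le_of_le_one_left (by positivity) (by linarith)
          calc (1 - δ) * γ * (2 - γ) * rho A G b x
              = (1 - δ) * (γ * (2 - γ)) * rho A G b x := by ring
            _ ≤ γ * (2 - γ) * K := by gcongr
        · have := lambdaMax_nonneg hG
          have : 0 < 2 * γ * rho A G b x := by positivity
          linarith
      _ = _ := by field_simp
  refine ⟨(1 / 2 : ℝ) • Theta A G b γ x x', ?_, ?_⟩
  · rw [Theta, smul_add, smul_sub, smul_smul, smul_smul, smul_smul]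
    norm_num
    rw [show (1 / 2 : ℝ) * (γ * rho A G b x) = γ * rho A G b x / 2 by ring]
    abel
  · rw [norm_smul]
    have h1 : α * ‖residual A b x‖ ≤
        γ * (2 - γ) * (K / (4 * specNorm (A.transpose * G)) / μ) * ‖residual A b x‖ := by gcongr
    norm_num
    linarith [norm_nonneg (Theta A G b γ x x')]

/-! ### The energy: distance to the cone of homogeneous solutions -/

/-- A point of the cone `A x = |x|` nearest to a given one in the norm defined by `G`. -/
theorem exists_nearest_homogeneous_solution {n : ℕ} {A : Matrix (Fin n) (Fin n) ℝ}
    (hA : specNorm A⁻¹ = 1) {G : Matrix (Fin n) (Fin n) ℝ} (hG : G.PosDef) (y : Vec n) :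
    ∃ z, residual A 0 z = 0 ∧ ∀ z', residual A 0 z' = 0 →
      inner ℝ (y - act A z) (act G (y - act A z)) ≤
        inner ℝ (y - act A z') (act G (y - act A z')) := by
  obtain ⟨m, hm, hmG⟩ := exists_coercive hG
  let f : Vec n → ℝ := fun z => inner ℝ (y - act A z) (act G (y - act A z))
  have hf : Continuous f := by
    have h : Continuous fun z => y - act A z := continuous_const.sub (act A).continuous
    exact h.inner ((act G).continuous.comp h)
  have h00 : residual A 0 (0 : Vec n) = 0 := by simp [residual, vabs_zero]
  have hK : IsCompact {z | residual A 0 z = 0 ∧ f z ≤ f 0} := by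
    refine Metric.isCompact_of_isClosed_isBounded ?_ ?_
    · exact (isClosed_eq (continuous_residual A 0) continuous_const).inter
        (isClosed_le hf continuous_const)
    · refine Metric.isBounded_closedBall.subset (t := Metric.closedBall 0 (‖y‖ + (f 0 / m + 1)))
        fun z hz => ?_
      rw [mem_closedBall_zero_iff]
      have h1 : ‖z‖ ≤ ‖act A z‖ := by
        have := norm_act_inv_le hA (act A z)
        rwa [act_inv_act (isUnit_det_of_specNorm_inv hA)] at this
      have h2 : ‖act A z‖ ≤ ‖y‖ + ‖y - act A z‖ := by
        simpa using norm_sub_le y (y - act A z)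
      have h3 : ‖y - act A z‖ ^ 2 ≤ f 0 / m := by
        rw [le_div_iff₀ hm, mul_comm]
        exact (hmG _).trans hz.2
      nlinarith [sq_nonneg (‖y - act A z‖ - 1)]
  obtain ⟨z, hz, hmin⟩ := hK.exists_isMinOn ⟨0, h00, le_rfl⟩ hf.continuousOn
  refine ⟨z, hz.1, fun z' hz' => ?_⟩
  by_cases h : f z' ≤ f 0
  · exact hmin ⟨hz', h⟩
  · exact hz.2.trans (not_le.1 h).le

theorem inner_act_step {n : ℕ} {G : Matrix (Fin n) (Fin n) ℝ} (hG : G.PosDef)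
    (d e r : Vec n) (c : ℝ) :
    inner ℝ (d - c • act G⁻¹ e + r) (act G (d - c • act G⁻¹ e + r)) =
      inner ℝ d (act G d) + c ^ 2 * inner ℝ e (act G⁻¹ e) + inner ℝ r (act G r)
        - 2 * c * inner ℝ d e + 2 * inner ℝ d (act G r) - 2 * c * inner ℝ r e := by
  have hGe : act G (act G⁻¹ e) = e := act_act_inv hG.det_pos.ne'.isUnit e
  have h1 := inner_act_comm hG (act G⁻¹ e) d
  have h2 := inner_act_comm hG (act G⁻¹ e) r
  rw [hGe] at h1 h2
  simp only [map_add, map_sub, map_smul, hGe, inner_add_left, inner_add_right, inner_sub_left,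
    inner_sub_right, real_inner_smul_left, real_inner_smul_right, h1, h2,
    inner_act_comm hG r d, real_inner_comm e (act G⁻¹ e)]
  ring

/-- Here `s = ‖e₀(x)‖`, `β = ‖b‖`, `E = ‖e(x)‖`, `R = ‖r‖`, `g = ‖G‖`, and `d`, `p` stand for `‖Ax -
Az‖`, `⟨Ax - Az, e(x)⟩`. Cocoercivity gains `γρs²/2`, the squared step costs `γ²ρs²/4`, and the
margin is at least `γ(2-γ)as²/4`. By `hsmall` the perturbation uses at most half of it, up to a
constant. -/
theorem energy_increment_le {a K C g β γ ρ s θ E R d p : ℝ} (ha : 0 < a) (haρ : a ≤ ρ)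
    (hρK : ρ ≤ K) (hC : 0 ≤ C) (hg : 0 ≤ g) (hβ : 0 ≤ β) (hγ : 0 < γ) (hγ2 : γ < 2) (hs : 0 ≤ s)
    (hθ : 0 ≤ θ) (hθ1 : θ ≤ 1) (hE : 0 ≤ E) (hEs : E ≤ s + β) (hR : 0 ≤ R) (hRE : R ≤ θ * E)
    (hds : d ≤ C * s) (hp : s ^ 2 / 2 - C * s * β ≤ p)
    (hsmall : θ * (g + 2 * g * C + 2 * K) ≤ γ * (2 - γ) * a / 16) :
    γ ^ 2 / 4 * (ρ * E ^ 2) + g * R ^ 2 - γ * ρ * p + 2 * (d * (g * R)) + γ * ρ * (R * E) ≤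
      γ * (-((2 - γ) * a / 8 * s ^ 2) + (K * β + K * C * β) * s +
        (K * β ^ 2 / 2 + a * β ^ 2 / 4)) := by
  have hρ : 0 < ρ := ha.trans_le haρ
  have hK : 0 < K := hρ.trans_le hρK
  have h2γ : 0 < 2 - γ := by linarith
  have hE2 : E ^ 2 ≤ (s + β) ^ 2 := by gcongr
  have hRs : R ≤ θ * (s + β) := hRE.trans (by gcongr)
  have e1 : g * R ^ 2 ≤ θ * g * (s + β) ^ 2 := by
    calc g * R ^ 2 ≤ g * (θ * (s + β)) ^ 2 := by gcongr
      _ = θ * (θ * g * (s + β) ^ 2) := by ring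
      _ ≤ 1 * (θ * g * (s + β) ^ 2) := by gcongr
      _ = _ := one_mul _
  have e2 : 2 * (d * (g * R)) ≤ θ * (2 * g * C) * (s + β) ^ 2 := by
    calc 2 * (d * (g * R)) ≤ 2 * ((C * s) * (g * (θ * (s + β)))) := by gcongr
      _ ≤ 2 * ((C * (s + β)) * (g * (θ * (s + β)))) := by gcongr; linarith
      _ = _ := by ring
  have e3 : γ * ρ * (R * E) ≤ θ * (2 * K) * (s + β) ^ 2 := by
    calc γ * ρ * (R * E) ≤ 2 * K * ((θ * (s + β)) * (s + β)) := by gcongr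
      _ = _ := by ring
  have e4 : g * R ^ 2 + 2 * (d * (g * R)) + γ * ρ * (R * E) ≤
      γ * (2 - γ) * a / 16 * (2 * s ^ 2 + 2 * β ^ 2) := by
    calc _ ≤ θ * (g + 2 * g * C + 2 * K) * (s + β) ^ 2 := by linarith
      _ ≤ γ * (2 - γ) * a / 16 * (2 * s ^ 2 + 2 * β ^ 2) := by
        gcongr
        nlinarith [sq_nonneg (s - β)]
  have e5 : γ ^ 2 / 4 * (ρ * E ^ 2) - γ * ρ * p ≤
      -(γ * (2 - γ) / 4 * ρ * s ^ 2) + γ * ρ * (C * s * β) +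
        γ ^ 2 / 4 * ρ * (2 * s * β + β ^ 2) := by
    have h1 : γ ^ 2 / 4 * (ρ * E ^ 2) ≤ γ ^ 2 / 4 * (ρ * (s + β) ^ 2) := by gcongr
    have h2 : γ * ρ * (s ^ 2 / 2 - C * s * β) ≤ γ * ρ * p := by gcongr
    linarith
  have e6 : γ * (2 - γ) / 4 * a * s ^ 2 ≤ γ * (2 - γ) / 4 * ρ * s ^ 2 := by gcongr
  have e7 : γ * ρ * (C * s * β) ≤ γ * K * (C * s * β) := by gcongr
  have e8 : γ ^ 2 / 4 * ρ * (2 * s * β + β ^ 2) ≤ γ / 2 * K * (2 * s * β + β ^ 2) := by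
    have : γ ^ 2 / 4 ≤ γ / 2 := by nlinarith
    gcongr
  have e9 : γ * (2 - γ) * a / 16 * (2 * β ^ 2) ≤ γ * (a * β ^ 2 / 4) := by
    have h : γ * (2 - γ) ≤ γ * 2 := by gcongr; linarith
    calc γ * (2 - γ) * a / 16 * (2 * β ^ 2) ≤ γ * 2 * a / 16 * (2 * β ^ 2) := by gcongr
      _ = _ := by ring
  linarith

/-- Error bound for the points of the cone `A x = |x|` that are nearest in the norm of `G`. -/
theorem exists_nearest_error_bound {n : ℕ} (A : Matrix (Fin n) (Fin n) ℝ)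
    {G : Matrix (Fin n) (Fin n) ℝ} (hG : G.PosDef) :
    ∃ C : ℝ, 0 ≤ C ∧ ∀ x z : Vec n, (∀ z', residual A 0 z' = 0 →
      inner ℝ (act A x - act A z) (act G (act A x - act A z)) ≤
        inner ℝ (act A x - act A z') (act G (act A x - act A z'))) →
      ‖act A x - act A z‖ ≤ C * ‖residual A 0 x‖ := by
  obtain ⟨C₀, hC₀, hbound⟩ := exists_homogeneous_error_bound A
  obtain ⟨m, hm, hmG⟩ := exists_coercive hG
  have hq : 0 ≤ ‖act G‖ / m := by positivity
  refine ⟨(‖act G‖ / m + 1) * (‖act A‖ * C₀), by positivity, fun x z hz => ?_⟩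
  -- The point `z'` of the error bound competes with the nearest `z`; comparing the `G`-norm with
  -- the Euclidean one costs the factor `‖G‖ / m`.
  obtain ⟨z', hz', -, hzn⟩ := hbound x
  have h1 : ‖act A x - act A z'‖ ≤ ‖act A‖ * C₀ * ‖residual A 0 x‖ := by
    rw [← map_sub, mul_assoc]
    exact (act A).le_opNorm_of_le hzn
  have h2 := (hmG _).trans ((hz z' hz').trans (inner_act_le G _ _))
  have h4 : ‖act A x - act A z‖ ^ 2 ≤ ‖act G‖ / m * ‖act A x - act A z'‖ ^ 2 := by
    rw [div_mul_eq_mul_div, le_div_iff₀ hm]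
    linarith
  have h5 : ‖act G‖ / m ≤ (‖act G‖ / m + 1) ^ 2 := by nlinarith
  refine (sq_le_sq₀ (norm_nonneg _) (by positivity)).1 ?_
  calc ‖act A x - act A z‖ ^ 2 ≤ ‖act G‖ / m * ‖act A x - act A z'‖ ^ 2 := h4
    _ ≤ (‖act G‖ / m + 1) ^ 2 * (‖act A‖ * C₀ * ‖residual A 0 x‖) ^ 2 := by gcongr
    _ = _ := by ring

/-- The reference point `z` stays fixed during the step. As `e₀(z) = 0`, cocoercivity of `e₀` gives
`⟨Ax - Az, e₀(x)⟩ ≥ s²/2`, and the error bound limits the contribution of `b` to one linear in `s`.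
-/
theorem exists_nearest_energy_increment {n : ℕ} {A : Matrix (Fin n) (Fin n) ℝ}
    (hA : specNorm A⁻¹ = 1) {b : Vec n} (hS : solutionSet A b = ∅)
    {G : Matrix (Fin n) (Fin n) ℝ} (hG : G.PosDef) :
    ∃ a D₁ D₀ μ₁ : ℝ, 0 < a ∧ 0 ≤ D₁ ∧ 0 ≤ D₀ ∧ 0 < μ₁ ∧ ∀ μ, μ₁ ≤ μ →
      ∀ γ, 0 < γ → γ < 2 → ∀ δ, 0 < δ → δ < 1 → ∀ x x', InexactStep A G b γ δ μ x x' →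
        ∀ z, residual A 0 z = 0 → (∀ z', residual A 0 z' = 0 →
          inner ℝ (act A x - act A z) (act G (act A x - act A z)) ≤
            inner ℝ (act A x - act A z') (act G (act A x - act A z'))) →
        inner ℝ (act A x' - act A z) (act G (act A x' - act A z)) -
          inner ℝ (act A x - act A z) (act G (act A x - act A z)) ≤
        γ * (-((2 - γ) * a / 8 * ‖residual A 0 x‖ ^ 2) + D₁ * ‖residual A 0 x‖ + D₀) := by
  obtain ⟨C, hC0, hnear⟩ := exists_nearest_error_bound A hG
  obtain ⟨a, K, ha, hK, hρ⟩ := exists_rho_bounds A b hG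
  obtain ⟨K₁, hK₁, hstep⟩ := exists_step_perturbation hA hS hG
  obtain ⟨g, hg⟩ : ∃ g, g = ‖act G‖ := ⟨_, rfl⟩
  obtain ⟨β, hβ⟩ : ∃ β, β = ‖b‖ := ⟨_, rfl⟩
  have hg0 : 0 ≤ g := hg ▸ norm_nonneg _
  have hβ0 : 0 ≤ β := hβ ▸ norm_nonneg _
  refine ⟨a, K * β + K * C * β, K * β ^ 2 / 2 + a * β ^ 2 / 4,
    K₁ + 16 * K₁ * (g + 2 * g * C + 2 * K) / a, ha, by positivity, by positivity, by positivity,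
    fun μ hμ γ hγ hγ2 δ hδ hδ1 x x' hxx' z hz0 hz => ?_⟩
  have hμ0 : 0 < μ := lt_of_lt_of_le (by positivity) hμ
  have h2γ : 0 < 2 - γ := by linarith
  have hx : residual A b x ≠ 0 := fun h =>
    (hS ▸ (show x ∈ solutionSet A b from h) : x ∈ (∅ : Set (Vec n)))
  obtain ⟨hρa, hρK, hρe⟩ := hρ x hx
  obtain ⟨r, hr, hrn⟩ := hstep μ hμ0 γ hγ hγ2 δ hδ hδ1 x x' hxx'
  have hds := hnear x z hz
  have he0 : residual A b x = residual A 0 x - b := residual_eq_sub A b x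
  have hcoc := residual_cocoercive hA 0 x z
  have hd' : act A x' - act A z = (act A x - act A z) -
      (γ * rho A G b x / 2) • act G⁻¹ (residual A b x) + r := by
    rw [hr]; abel
  rw [hd', inner_act_step hG]
  rw [hz0, sub_zero] at hcoc
  clear hr hd' hz hnear hstep hρ hxx'
  generalize rho A G b x = ρ at *
  generalize act A x - act A z = d at *
  generalize hs : ‖residual A 0 x‖ = s at *
  have hs0 : 0 ≤ s := hs ▸ norm_nonneg _
  generalize residual A b x = e at *
  have hes : ‖e‖ ≤ s + β := by rw [he0, hβ, ← hs]; exact norm_sub_le _ _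
  have hde : s ^ 2 / 2 - C * s * β ≤ inner ℝ d e := by
    have h2 : inner ℝ d b ≤ C * s * β :=
      (real_inner_le_norm _ _).trans (by rw [← hβ]; gcongr)
    rw [he0, inner_sub_right]
    linarith
  set θ := γ * (2 - γ) * (K₁ / μ) with hθ
  have hθ0 : 0 ≤ θ := by positivity
  have hθ1 : θ ≤ 1 := by
    have h1 : K₁ / μ ≤ 1 := by
      rw [div_le_one hμ0]
      exact le_trans (le_add_of_nonneg_right (by positivity)) hμ
    have h2 : γ * (2 - γ) ≤ 1 := by nlinarith [sq_nonneg (γ - 1)]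
    exact mul_le_one₀ h2 (by positivity) h1
  have hsmall : θ * (g + 2 * g * C + 2 * K) ≤ γ * (2 - γ) * a / 16 := by
    have h1 : 16 * K₁ * (g + 2 * g * C + 2 * K) / a ≤ μ :=
      le_trans (le_add_of_nonneg_left hK₁.le) hμ
    have h2 : K₁ / μ * (g + 2 * g * C + 2 * K) ≤ a / 16 := by
      rw [div_le_iff₀ ha] at h1
      rw [div_mul_eq_mul_div, div_le_iff₀ hμ0]
      linarith
    calc θ * (g + 2 * g * C + 2 * K)
        = γ * (2 - γ) * (K₁ / μ * (g + 2 * g * C + 2 * K)) := by rw [hθ]; ring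
      _ ≤ γ * (2 - γ) * (a / 16) := by gcongr
      _ = _ := by ring
  have hmain := energy_increment_le ha hρa hρK hC0 hg0 hβ0 hγ hγ2 hs0 hθ0 hθ1 (norm_nonneg e)
    hes (norm_nonneg r) hrn hds hde hsmall
  have h1 : (γ * ρ / 2) ^ 2 * inner ℝ e (act G⁻¹ e) = γ ^ 2 / 4 * (ρ * ‖e‖ ^ 2) := by
    rw [← hρe]; ring
  have h2 : inner ℝ r (act G r) ≤ g * ‖r‖ ^ 2 := (inner_act_le G r r).trans_eq (by rw [hg]; ring)
  have h3 : inner ℝ d (act G r) ≤ ‖d‖ * (g * ‖r‖) :=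
    hg ▸ inner_act_le G d r
  have h4 : -(γ * ρ * inner ℝ r e) ≤ γ * ρ * (‖r‖ * ‖e‖) := by
    rw [← mul_neg]
    have := neg_le_of_abs_le (abs_real_inner_le_norm r e)
    have : 0 ≤ γ * ρ := mul_nonneg hγ.le (ha.le.trans hρa)
    gcongr
    linarith
  rw [h1]
  linarith

/-- The squared distance of `A x` to the image of the cone `A x = |x|` is an energy which controls
the average size of the residuals. -/
theorem exists_energy {n : ℕ} {A : Matrix (Fin n) (Fin n) ℝ}
    (hA : specNorm A⁻¹ = 1) {b : Vec n} (hS : solutionSet A b = ∅)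
    {G : Matrix (Fin n) (Fin n) ℝ} (hG : G.PosDef) :
    ∃ W : Vec n → ℝ, ∃ D μ₁ : ℝ, (∀ x, 0 ≤ W x) ∧ 0 ≤ D ∧ 0 < μ₁ ∧ ∀ μ, μ₁ ≤ μ →
      ∀ γ, 0 < γ → γ < 2 → ∀ δ, 0 < δ → δ < 1 → ∀ x x', InexactStep A G b γ δ μ x x' →
        (2 - γ) * (W x' - W x) ≤ γ * (D - (2 - γ) * ‖residual A 0 x‖) := by
  choose P hP0 hP using fun y : Vec n => exists_nearest_homogeneous_solution hA hG y
  obtain ⟨m, hm, hmG⟩ := exists_coercive hG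
  obtain ⟨a, D₁, D₀, μ₁, ha, hD₁, hD₀, hμ₁, hinc⟩ := exists_nearest_energy_increment hA hS hG
  refine ⟨fun x => inner ℝ (act A x - act A (P (act A x))) (act G (act A x - act A (P (act A x)))),
    2 * (D₁ + 1) ^ 2 / a + 2 * D₀, μ₁,
    fun x => (by positivity : (0 : ℝ) ≤ _).trans (hmG _), by positivity, hμ₁,
    fun μ hμ γ hγ hγ2 δ hδ hδ1 x x' hxx' => ?_⟩
  have h2γ : 0 < 2 - γ := by linarith
  -- The nearest cone point for `x'` is no farther than the one for `x`.
  have hW := hP (act A x') (P (act A x)) (hP0 _)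
  have hΔ := (sub_le_sub_right hW _).trans
    (hinc μ hμ γ hγ hγ2 δ hδ hδ1 x x' hxx' (P (act A x)) (hP0 _) (hP _))
  generalize ‖residual A 0 x‖ = s at *
  have hτ : (2 - γ) * (-((2 - γ) * a / 8 * s ^ 2) + D₁ * s + D₀) ≤
      2 * (D₁ + 1) ^ 2 / a + 2 * D₀ - (2 - γ) * s := by
    -- Maximizing the quadratic in `t = (2-γ)s` gives a bound free of `γ`, which is why the
    -- increment is multiplied by `2 - γ`. The `1` in `D₁ + 1` leaves the term `-t` over.
    have h5 : (D₁ + 1) * ((2 - γ) * s) - a / 8 * ((2 - γ) * s) ^ 2 ≤ 2 * (D₁ + 1) ^ 2 / a := by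
      rw [le_div_iff₀ ha]
      nlinarith [sq_nonneg (a * ((2 - γ) * s) - 4 * (D₁ + 1))]
    have h6 : (2 - γ) * D₀ ≤ 2 * D₀ := by gcongr; linarith
    linarith
  calc _ ≤ (2 - γ) * (γ * (-((2 - γ) * a / 8 * s ^ 2) + D₁ * s + D₀)) := by gcongr
    _ = γ * ((2 - γ) * (-((2 - γ) * a / 8 * s ^ 2) + D₁ * s + D₀)) := by ring
    _ ≤ _ := by gcongr

/-! ### Decrease along the separating direction and divergence -/

/-- In `ℓ = ⟨v, GA·⟩` the factor `G` cancels the `G⁻¹` of the step, leaving `⟨v, e(x)⟩`, which is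
bounded below by separation. -/
theorem exists_linear_functional_decrease {n : ℕ} {A : Matrix (Fin n) (Fin n) ℝ}
    (hA : specNorm A⁻¹ = 1) {b : Vec n} (hS : solutionSet A b = ∅)
    {G : Matrix (Fin n) (Fin n) ℝ} (hG : G.PosDef) :
    ∃ ℓ : Vec n →L[ℝ] ℝ, ∃ c D : ℝ, 0 < c ∧ 0 < D ∧ ∀ μ, 0 < μ →
      ∀ γ, 0 < γ → γ < 2 → ∀ δ, 0 < δ → δ < 1 → ∀ x x', InexactStep A G b γ δ μ x x' →
        ℓ x' - ℓ x ≤ γ * (D / μ * ((2 - γ) * ‖residual A 0 x‖ + 2 * ‖b‖) - c) := by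
  obtain ⟨v, c, hc, hv⟩ := exists_separating_vector hA hS
  obtain ⟨a, K, ha, hK, hρ⟩ := exists_rho_bounds A b hG
  obtain ⟨K₁, hK₁, hstep⟩ := exists_step_perturbation hA hS hG
  refine ⟨(innerSL ℝ v).comp ((act G).comp (act A)), a * c / 2, (‖v‖ * ‖act G‖ + 1) * K₁,
    by positivity, by positivity, fun μ hμ0 γ hγ hγ2 δ hδ hδ1 x x' hxx' => ?_⟩
  have h2γ : 0 < 2 - γ := by linarith
  have hx : residual A b x ≠ 0 := fun h =>
    (hS ▸ (show x ∈ solutionSet A b from h) : x ∈ (∅ : Set (Vec n)))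
  obtain ⟨hρa, -, -⟩ := hρ x hx
  obtain ⟨r, hr, hrn⟩ := hstep μ hμ0 γ hγ hγ2 δ hδ hδ1 x x' hxx'
  have hes : ‖residual A b x‖ ≤ ‖residual A 0 x‖ + ‖b‖ := by
    rw [residual_eq_sub A b x]; exact norm_sub_le _ _
  have hGe : act G (act G⁻¹ (residual A b x)) = residual A b x :=
    act_act_inv hG.det_pos.ne'.isUnit _
  simp only [ContinuousLinearMap.comp_apply, innerSL_apply_apply]
  rw [hr, map_add, map_sub, map_smul, hGe, inner_add_right, inner_sub_right,
    real_inner_smul_right]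
  have h1 : γ * (a * c / 2) ≤ γ * rho A G b x / 2 * inner ℝ v (residual A b x) := by
    calc γ * (a * c / 2) = γ * a / 2 * c := by ring
      _ ≤ γ * rho A G b x / 2 * inner ℝ v (residual A b x) := by
        have : 0 ≤ γ * rho A G b x / 2 := by
          have := ha.le.trans hρa
          positivity
        gcongr
        exact hv x
  have h2 : inner ℝ v (act G r) ≤
      γ * ((‖v‖ * ‖act G‖ + 1) * K₁ / μ * ((2 - γ) * ‖residual A 0 x‖ + 2 * ‖b‖)) := by
    calc inner ℝ v (act G r) ≤ ‖v‖ * (‖act G‖ * ‖r‖) := inner_act_le G v r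
      _ = ‖v‖ * ‖act G‖ * ‖r‖ := by ring
      _ ≤ (‖v‖ * ‖act G‖ + 1) *
          (γ * (2 - γ) * (K₁ / μ) * (‖residual A 0 x‖ + ‖b‖)) := by
        have := hrn.trans (mul_le_mul_of_nonneg_left hes
          (by positivity : 0 ≤ γ * (2 - γ) * (K₁ / μ)))
        gcongr
        linarith
      _ = γ * ((‖v‖ * ‖act G‖ + 1) * K₁ / μ *
          ((2 - γ) * ‖residual A 0 x‖ + (2 - γ) * ‖b‖)) := by ring
      _ ≤ _ := by gcongr; linarith
  linarith

end AVE

theorem theorem4p5 (n : ℕ) (A : Matrix (Fin n) (Fin n) ℝ) (b : AVE.Vec n)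
    (hA : AVE.specNorm A⁻¹ = 1) (hS : AVE.solutionSet A b = ∅)
    (G : Matrix (Fin n) (Fin n) ℝ) (hG : G.PosDef) :
    ∃ μ₀ : ℝ, 0 < μ₀ ∧
      ∀ μ : ℝ, μ₀ ≤ μ → ∀ γ : ℝ, 0 < γ → γ < 2 → ∀ δ : ℝ, 0 < δ → δ < 1 →
        ∀ x : ℕ → AVE.Vec n, AVE.IsInexactDRS A G b γ δ μ x →
          Filter.Tendsto (fun k => ‖x k‖) Filter.atTop Filter.atTop := by
  obtain ⟨W, D, μ₁, hW0, hD, hμ₁, hW⟩ := AVE.exists_energy hA hS hG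
  obtain ⟨ℓ, c, D', hc, hD', hℓ⟩ := AVE.exists_linear_functional_decrease hA hS hG
  refine ⟨μ₁ + 2 * D' * (2 * ‖b‖ + D) / c, by positivity,
    fun μ hμ γ hγ hγ2 δ hδ hδ1 x hx => ?_⟩
  have hμ1 : μ₁ ≤ μ := le_trans (le_add_of_nonneg_right (by positivity)) hμ
  have hμ0 : 0 < μ := hμ₁.trans_le hμ1
  have h2γ : 0 < 2 - γ := by linarith
  have hsmall : D' / μ * (2 * ‖b‖ + D) ≤ c / 2 := by
    have h1 : 2 * D' * (2 * ‖b‖ + D) / c ≤ μ := le_trans (le_add_of_nonneg_left hμ₁.le) hμ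
    rw [div_le_iff₀ hc] at h1
    rw [div_mul_eq_mul_div, div_le_iff₀ hμ0]
    linarith
  have hstep : ∀ k, AVE.InexactStep A G b γ δ μ (x k) (x (k + 1)) := fun k =>
    (hx k).1 (by rw [hS]; exact Set.notMem_empty _)
  -- The weight `D'/μ` on the energy cancels the error term in `‖e₀(x k)‖`. What is left is a
  -- constant that the choice of `μ₀` keeps below `c/2`.
  set Ψ : ℕ → ℝ := fun k => ℓ (x k) + D' / μ * ((2 - γ) * W (x k)) with hΨ
  have hdec : ∀ k, Ψ (k + 1) ≤ Ψ k - γ * (c / 2) := by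
    intro k
    have h1 := hW μ hμ1 γ hγ hγ2 δ hδ hδ1 _ _ (hstep k)
    have h2 := hℓ μ hμ0 γ hγ hγ2 δ hδ hδ1 _ _ (hstep k)
    have h3 := mul_le_mul_of_nonneg_left h1 (by positivity : 0 ≤ D' / μ)
    have h4 := mul_le_mul_of_nonneg_left hsmall hγ.le
    simp only [hΨ]
    linarith
  have hΨk : ∀ k : ℕ, Ψ k ≤ Ψ 0 - k * (γ * (c / 2)) := by
    intro k
    induction k with
    | zero => simp
    | succ k ih =>
      have := hdec k
      push_cast
      linarith
  have hlow : ∀ k : ℕ, (k * (γ * (c / 2)) - Ψ 0) / (‖ℓ‖ + 1) ≤ ‖x k‖ := by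
    intro k
    rw [div_le_iff₀ (by positivity)]
    have h1 := ℓ.le_opNorm (x k)
    have h2 := neg_le_abs (ℓ (x k))
    have h3 : 0 ≤ D' / μ * ((2 - γ) * W (x k)) :=
      mul_nonneg (by positivity) (mul_nonneg h2γ.le (hW0 _))
    have h4 := hΨk k
    simp only [hΨ] at h4 ⊢
    rw [Real.norm_eq_abs] at h1
    linarith [norm_nonneg (x k)]
  refine Filter.tendsto_atTop_mono hlow ?_
  refine Filter.Tendsto.atTop_div_const (by positivity) ?_
  exact Filter.tendsto_atTop_add_const_right _ _
    (tendsto_natCast_atTop_atTop.atTop_mul_const (by positivity))
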